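/- **Notation.** Let $Gr=Gr(2,\mathbb{R}^4)$ be the Grassmannian of 2-planes in $\mathbb{R}^4$. For $g\in SL(4,\mathbb{R})$ let $\Psi_g:M_2(\mathbb{R})\to Gr$ be the chart sending $X$ to the column span of $u_g(X):=g\binom{X}{I}$. Write $h^{-1}g=\begin{pmatrix}k_{11}&k_{12}\\k_{21}&k_{22}\end{pmatrix}$ in $2\times2$ blocks. The change of coordinates from the chart of $g$ to that of $h$ is $\Psi_{g,h}(X)=(k_{11}X+k_{12})(k_{21}X+k_{22})^{-1}$, defined where $\det(k_{21}X+k_{22})\neq0$. Let $\mathcal{P}\subset Gr\times\mathbb{R}^4$ be the universal bundle, whose fibre at $p$ is $p$; the columns of $u_g$ form a frame of $\mathcal{P}$ over the chart of $g$. Let $\widetilde{\varepsilon[-1]}=\Lambda^2\mathcal{P}\otimes\tilde\varepsilon$, where $\tilde\varepsilon$ is the line bundle with transition functions $\det(k_{21}X+k_{22})/|\det(k_{21}X+k_{22})|$. A smooth section $s$ of $\widetilde{\varepsilon[-1]}$ is thus a family of smooth functions $f_g:M_2(\mathbb{R})\to\mathbb{R}$, $g\in SL(4,\mathbb{R})$,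 with $f_h\circ\Psi_{g,h}=|\det(k_{21}X+k_{22})|\,f_g$ on overlaps; it is nowhere vanishing if no $f_g$ has a zero. The equation $\square_{2,2}s=0$ means that $\frac{\partial^2 f_g}{\partial x_{11}\partial x_{22}}-\frac{\partial^2 f_g}{\partial x_{12}\partial x_{21}}=0$ for every $g$. For a nowhere vanishing smooth $f:M_2(\mathbb{R})\to\mathbb{R}$ put $$A(f)=-\frac1f\,\frac{\partial f}{\partial X}\,dX,\qquad \Big(\frac{\partial f}{\partial X}\Big)_{ij}=\frac{\partial f}{\partial x_{ji}},\qquad dX=(dx_{ij}),$$ an $M_2(\mathbb{R})$-valued 1-form. A connection $\nabla$ on $\mathcal{P}$ has connection potential $A$ in the frame $u_g$ if $\nabla(u_gv)=u_g(dv+Av)$; its curvature in this frame is $dA+A\wedge A$. The curvature is anti-self-dual (ASD) if in every chart it satisfies $*F=-F$, where $*$ is the Hodge operator on 2-forms, $\alpha\wedge *\beta=(\alpha,\beta)\,dV$, of the metric $ds^2=2(dx_{11}dx_{22}-dx_{12}dx_{21})$ and the volume form $dV=dx_{11}\wedge dx_{21}\wedge dx_{12}\wedge dx_{22}$. **Theorem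 (Global t'Hooft ansatz).** (1) There is a unique map $\phi$ from the set of nowhere vanishing smooth sections of $\widetilde{\varepsilon[-1]}$ to the set of smooth connections on $\mathcal{P}$ such that, for every such section $s=(f_g)_g$ and every $g\in SL(4,\mathbb{R})$, the connection potential of $\phi(s)$ in the frame $u_g$ is $A(f_g)$. (2) For every nowhere vanishing smooth section $s$ of $\widetilde{\varepsilon[-1]}$, the curvature of $\phi(s)$ is ASD if and only if $\square_{2,2}s=0$. -/

import Mathlib

open scoped Matrix ContDiff

/- A norm on real matrices is needed only to speak of derivatives; which one is immaterial. -/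
attribute [local instance] Matrix.normedAddCommGroup Matrix.normedSpace

noncomputable section

namespace SplitHooft

/-- Real `2 × 2` matrices: the domain of every chart, and the structure algebra. -/
abbrev M2 : Type := Matrix (Fin 2) (Fin 2) ℝ

/-- `ℝ⁴`, written as `ℝ² ⊕ ℝ²` so that `4 × 4` matrices come in `2 × 2` blocks. -/
abbrev R4 : Type := Fin 2 ⊕ Fin 2 → ℝ

/-- `SL(4, ℝ)`. -/
abbrev SL4 : Type := Matrix.SpecialLinearGroup (Fin 2 ⊕ Fin 2) ℝ

/-! ### The Grassmannian and its charts -/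

/-- The Grassmannian `Gr(2, ℝ⁴)`: the two-dimensional linear subspaces of `ℝ⁴`. -/
def Gr : Type := {p : Submodule ℝ R4 // Module.finrank ℝ p = 2}

/-- The `4 × 2` matrix `g (X ; I)`. Its columns are the frame of the universal bundle over the
chart attached to `g`. -/
def frame (g : SL4) (X : M2) : Matrix (Fin 2 ⊕ Fin 2) (Fin 2) ℝ :=
  (g : Matrix (Fin 2 ⊕ Fin 2) (Fin 2 ⊕ Fin 2) ℝ) * Matrix.fromRows X (1 : M2)

theorem frame_injective (g : SL4) (X : M2) :
    Function.Injective (frame g X).mulVecLin := by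
  intro v w h
  have h1 : (g : Matrix (Fin 2 ⊕ Fin 2) (Fin 2 ⊕ Fin 2) ℝ) *ᵥ (Matrix.fromRows X (1 : M2) *ᵥ v)
      = (g : Matrix (Fin 2 ⊕ Fin 2) (Fin 2 ⊕ Fin 2) ℝ) *ᵥ (Matrix.fromRows X (1 : M2) *ᵥ w) := by
    simpa [frame, Matrix.mulVec_mulVec] using h
  have h2 := congrArg (fun u => ((g⁻¹ : SL4) : Matrix (Fin 2 ⊕ Fin 2) (Fin 2 ⊕ Fin 2) ℝ) *ᵥ u) h1
  simp only [Matrix.mulVec_mulVec, ← Matrix.mul_assoc, ← Matrix.SpecialLinearGroup.coe_mul,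
    inv_mul_cancel, Matrix.SpecialLinearGroup.coe_one, Matrix.one_mul] at h2
  funext i
  have h3 := congrFun h2 (Sum.inr i)
  simpa [Matrix.fromRows_mulVec] using h3

/-- The chart `Ψ_g : M₂(ℝ) → Gr`: the plane spanned by the two columns of `g (X ; I)`. -/
def chart (g : SL4) (X : M2) : Gr :=
  ⟨LinearMap.range (frame g X).mulVecLin, by
    rw [LinearMap.finrank_range_of_inj (frame_injective g X)]; simp⟩

/-- The matrix `k = h⁻¹ g` that governs the change of coordinates from the chart of `g` to the
chart of `h`. -/
def transMat (g h : SL4) : Matrix (Fin 2 ⊕ Fin 2) (Fin 2 ⊕ Fin 2) ℝ :=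
  ((h⁻¹ * g : SL4) : Matrix (Fin 2 ⊕ Fin 2) (Fin 2 ⊕ Fin 2) ℝ)

/-- `k₂₁ X + k₂₂`: the transition function of the universal bundle. The overlap of the charts of
`g` and `h` is where its determinant is nonzero. -/
def den (g h : SL4) (X : M2) : M2 :=
  (transMat g h).toBlocks₂₁ * X + (transMat g h).toBlocks₂₂

/-- The change of coordinates `Ψ_{g,h}(X) = (k₁₁ X + k₁₂)(k₂₁ X + k₂₂)⁻¹`. -/
def coordChange (g h : SL4) (X : M2) : M2 :=
  ((transMat g h).toBlocks₁₁ * X + (transMat g h).toBlocks₁₂) * (den g h X)⁻¹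

/-- A real function on `Gr` is smooth if it is smooth in each of the charts `Ψ_g`. -/
def SmoothOnGr (f : Gr → ℝ) : Prop :=
  ∀ g : SL4, ContDiff ℝ ∞ (fun X => f (chart g X))

/-! ### Line bundles on the Grassmannian, given by transition functions -/

/-- Transition functions of `ε[n]`, where `ε[-1] = Λ² 𝒫` has transition functions
`det (k₂₁ X + k₂₂)` and `ε[n] = ε[-1]^{-n}`. -/
def epsTransition (n : ℤ) (g h : SL4) (X : M2) : ℝ := (den g h X).det ^ (-n)

/-- Transition functions of the locally constant line bundle `ε̃`. -/
def tildeTransition (g h : SL4) (X : M2) : ℝ := (den g h X).det / |(den g h X).det|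

/-- Transition functions of the twisted bundle `ε[n] ⊗ ε̃`. -/
def twistedEpsTransition (n : ℤ) (g h : SL4) (X : M2) : ℝ :=
  epsTransition n g h X * tildeTransition g h X

/-- Smooth sections of the line bundle over `Gr` with transition functions `c`: the local
coefficient functions `f_g : M₂(ℝ) → ℝ` in all charts, matching on overlaps. -/
structure LineSection (c : SL4 → SL4 → M2 → ℝ) where
  coeff : SL4 → M2 → ℝ
  smooth : ∀ g, ContDiff ℝ ∞ (coeff g)
  compat : ∀ g h X, (den g h X).det ≠ 0 →
    coeff h (coordChange g h X) = c g h X * coeff g X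

/-- The nowhere vanishing smooth sections of the twisted bundle `ε[-1] ⊗ ε̃`. -/
def NonvanishingSection : Type :=
  {s : LineSection (twistedEpsTransition (-1)) // ∀ g X, s.coeff g X ≠ 0}

/-- The partial derivative `∂f / ∂x_{ij}` of a function on `M₂(ℝ)`. -/
def pd (i j : Fin 2) (f : M2 → ℝ) (X : M2) : ℝ := fderiv ℝ f X (Matrix.single i j 1)

/-- The ultrahyperbolic operator `∂²/∂x₁₁∂x₂₂ - ∂²/∂x₁₂∂x₂₁` on functions on `M₂(ℝ)`. -/
def box (f : M2 → ℝ) (X : M2) : ℝ := pd 0 0 (pd 1 1 f) X - pd 0 1 (pd 1 0 f) X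

/-- The equation `□_{2,2} s = 0` for a section of `ε[-1] ⊗ ε̃`; the global operator is given in
each chart by the local one. -/
def SolvesBox (s : LineSection (twistedEpsTransition (-1))) : Prop :=
  ∀ g X, box (s.coeff g) X = 0

/-! ### The universal bundle, its sections and connections -/

/-- Smooth sections of the universal bundle `𝒫 ⊆ Gr × ℝ⁴`, whose fibre at `p` is `p` itself. -/
def sections : Submodule ℝ (Gr → R4) where
  carrier := {σ | (∀ p, σ p ∈ p.1) ∧ ∀ g : SL4, ContDiff ℝ ∞ (fun X => σ (chart g X))}
  add_mem' := fun ha hb =>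
    ⟨fun p => p.1.add_mem (ha.1 p) (hb.1 p), fun g => (ha.2 g).add (hb.2 g)⟩
  zero_mem' := ⟨fun p => p.1.zero_mem, fun _ => contDiff_const⟩
  smul_mem' := fun c _ ha =>
    ⟨fun p => p.1.smul_mem c (ha.1 p), fun g => contDiff_const.smul (ha.2 g)⟩

/-- The product of a smooth function and a smooth section of `𝒫`. -/
def mulSection (f : Gr → ℝ) (hf : SmoothOnGr f) (σ : sections) : sections :=
  ⟨fun p => f p • σ.1 p,
    fun p => p.1.smul_mem _ (σ.2.1 p), fun g => (hf g).smul (σ.2.2 g)⟩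

/-- Smooth `𝒫`-valued one-forms on `Gr`, as their pullbacks `w_g` under all charts: smooth
one-forms on `M₂(ℝ)` whose values at `X` lie in the fibre over `Ψ_g(X)` and which satisfy
`w_g = Ψ_{g,h}^* w_h` on overlaps. -/
def oneForms : Submodule ℝ (SL4 → M2 → M2 →ₗ[ℝ] R4) where
  carrier := {w | (∀ g H, ContDiff ℝ ∞ (fun X => w g X H)) ∧
    (∀ g X H, w g X H ∈ (chart g X).1) ∧
    ∀ g h X, (den g h X).det ≠ 0 →
      ∀ H, w g X H = w h (coordChange g h X) (fderiv ℝ (coordChange g h) X H)}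
  add_mem' := fun ha hb =>
    ⟨fun g H => (ha.1 g H).add (hb.1 g H),
      fun g X H => (chart g X).1.add_mem (ha.2.1 g X H) (hb.2.1 g X H),
      fun g h X hX H => congrArg₂ (· + ·) (ha.2.2 g h X hX H) (hb.2.2 g h X hX H)⟩
  zero_mem' := ⟨fun _ _ => contDiff_const, fun g X _ => (chart g X).1.zero_mem,
    fun _ _ _ _ _ => rfl⟩
  smul_mem' := fun c _ ha =>
    ⟨fun g H => contDiff_const.smul (ha.1 g H),
      fun g X H => (chart g X).1.smul_mem c (ha.2.1 g X H),
      fun g h X hX H => congrArg (c • ·) (ha.2.2 g h X hX H)⟩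

/-- A connection on the universal bundle: a linear operator from smooth sections to smooth
bundle-valued one-forms with the Leibniz rule `∇(f σ) = df ⊗ σ + f ∇σ`. -/
@[ext]
structure Connection where
  toFun : sections →ₗ[ℝ] oneForms
  leibniz : ∀ (f : Gr → ℝ) (hf : SmoothOnGr f) (σ : sections) (g : SL4) (X H : M2),
    (toFun (mulSection f hf σ)).1 g X H =
      fderiv ℝ (fun Y => f (chart g Y)) X H • σ.1 (chart g X)
        + f (chart g X) • (toFun σ).1 g X H

/-- `A`, an `M₂(ℝ)`-valued smooth one-form, is the connection potential of `D` in the frame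
`u = g (X ; I)` over the chart of `g`, that is, `∇(u v) = u (dv + A v)`. (The coefficient
vector `v` of a section exists, is unique and is smooth.) -/
def Connection.IsPotential (D : Connection) (g : SL4) (A : M2 → M2 →ₗ[ℝ] M2) : Prop :=
  (∀ H, ContDiff ℝ ∞ (fun X => A X H)) ∧
    ∀ (σ : sections) (v : M2 → Fin 2 → ℝ), (∀ X, σ.1 (chart g X) = frame g X *ᵥ v X) →
      ∀ X H, (D.toFun σ).1 g X H = frame g X *ᵥ (fderiv ℝ v X H + A X H *ᵥ v X)

/-! ### Curvature and anti-self-duality -/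

/-- The curvature `F = dA + A ∧ A` of a potential `A`, evaluated at `X` on `H, K`. -/
def curvature (A : M2 → M2 →ₗ[ℝ] M2) (X H K : M2) : M2 :=
  fderiv ℝ (fun Y => A Y K) X H - fderiv ℝ (fun Y => A Y H) X K + (A X H * A X K - A X K * A X H)

/-- The symmetric bilinear form of `ds² = 2 (dx₁₁ dx₂₂ - dx₁₂ dx₂₁)`, so that
`ds²(H, H) = 2 det H`. -/
def metric (H K : M2) : ℝ := H 0 0 * K 1 1 + H 1 1 * K 0 0 - H 0 1 * K 1 0 - H 1 0 * K 0 1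

/-- The coordinate basis `∂₁₁, ∂₂₁, ∂₁₂, ∂₂₂`, on which the volume form
`dV = dx₁₁ ∧ dx₂₁ ∧ dx₁₂ ∧ dx₂₂` takes the value `1`. -/
def orientedBasis : Fin 4 → M2 :=
  ![Matrix.single 0 0 1, Matrix.single 1 0 1, Matrix.single 0 1 1, Matrix.single 1 1 1]

/-- The Gram matrix of the metric in the coordinate basis. -/
def gram : Matrix (Fin 4) (Fin 4) ℝ :=
  Matrix.of fun a b => metric (orientedBasis a) (orientedBasis b)

/-- The inner product `(α, β)` of two-forms induced by the metric. -/
def formInner (α β : M2 → M2 → ℝ) : ℝ :=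
  1 / 2 * ∑ a, ∑ b, ∑ c, ∑ d, gram⁻¹ a c * gram⁻¹ b d *
    α (orientedBasis a) (orientedBasis b) * β (orientedBasis c) (orientedBasis d)

/-- The coefficient of `α ∧ β` with respect to `dV`. -/
def wedgeCoeff (α β : M2 → M2 → ℝ) : ℝ :=
  1 / 4 * ∑ τ : Equiv.Perm (Fin 4), ((Equiv.Perm.sign τ : ℤ) : ℝ) *
    α (orientedBasis (τ 0)) (orientedBasis (τ 1)) * β (orientedBasis (τ 2)) (orientedBasis (τ 3))

/-- `γ = *β`, that is, `α ∧ γ = (α, β) dV` for all two-forms `α`. -/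
def IsHodgeStar (β γ : M2 → M2 → ℝ) : Prop :=
  ∀ α : LinearMap.BilinForm ℝ M2, α.IsAlt →
    wedgeCoeff (fun H K => α H K) γ = formInner (fun H K => α H K) β

/-- A matrix-valued two-form `F` is anti-self-dual: `*F = -F`, entry by entry. -/
def IsASDForm (F : M2 → M2 → M2) : Prop :=
  ∀ i j, IsHodgeStar (fun H K => F H K i j) (fun H K => -F H K i j)

/-- The curvature of the connection is anti-self-dual: so is `dA + A ∧ A` for the connection
potential `A` in each chart. -/
def Connection.IsASD (D : Connection) : Prop :=
  ∀ g : SL4, ∃ A : M2 → M2 →ₗ[ℝ] M2, D.IsPotential g A ∧ ∀ X, IsASDForm (curvature A X)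

/-! ### The ansatz -/

/-- The matrix `∂f/∂X`, with entry `∂f/∂x_{ji}` in row `i` and column `j`. -/
def matGrad (f : M2 → ℝ) (X : M2) : M2 := Matrix.of fun i j => pd j i f X

/-- The local ansatz `A(f) = -((∂f/∂X) / f) dX`, a matrix-valued one-form: its value at `X`
on `H` is the matrix product `-(f X)⁻¹ (∂f/∂X) H`. -/
def localAnsatz (f : M2 → ℝ) (X : M2) : M2 →ₗ[ℝ] M2 :=
  LinearMap.mulLeft ℝ (-((f X)⁻¹ • matGrad f X))

/-- The map `φ` from nowhere vanishing sections to connections is given in every chart by the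
local ansatz. -/
def IsGlobalAnsatz (φ : NonvanishingSection → Connection) : Prop :=
  ∀ (s : NonvanishingSection) (g : SL4), (φ s).IsPotential g (localAnsatz (s.1.coeff g))

end SplitHooft

end

/-! Part (1) is a gauge computation. On an overlap put `D = k₂₁X + k₂₂` and `Ψ = Ψ_{g,h}`. The
frames satisfy `u_g = (u_h ∘ Ψ) D`, so local potentials glue to a connection exactly when `D A_g =
dD + (Ψ^*A_h) D`. Write `A_g = -B dX` and `A_h = -C dX`. The trace pairing identifies `B` and `C`
with the logarithmic differentials of `f_g` and `f_h`. The cocycle `|det D|` makes these differ by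
`d log |det D| = tr(D⁻¹ k₂₁ dX)`, while `dΨ = N dX D⁻¹` with `N = k₁₁ - Ψ k₂₁`. Hence `B = D⁻¹(C N -
k₂₁)`, which is the gauge law (`den_mul_ansatz`). Uniqueness holds because a connection is
determined by its potentials in all charts.

For part (2), `*F = -F` amounts to three linear equations on the components of each entry of `F`
(`isHodgeStar_neg_iff`). For the ansatz, the terms quadratic in the first derivatives of `f` cancel
in these combinations, leaving `0` or `± f⁻¹ □f` (`isASDForm_localAnsatz_iff`). Since
anti-self-duality is stated for some potential, one also needs that potentials are unique
(`Connection.IsPotential.unique`); this follows once global sections take every value at every point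
of a chart. -/

noncomputable section

namespace SplitHooft

/-! ### Entrywise calculus of matrix-valued functions -/

section Calculus

variable {E : Type*} [NormedAddCommGroup E] [NormedSpace ℝ E]
variable {l m n : Type*}

theorem contDiff_matrix_iff [Fintype m] [Fintype n] {k : WithTop ℕ∞} {M : E → Matrix m n ℝ} :
    ContDiff ℝ k M ↔ ∀ i j, ContDiff ℝ k fun x => M x i j :=
  contDiff_pi.trans (forall_congr' fun _ => contDiff_pi)

theorem contDiffAt_matrix_iff [Fintype m] [Fintype n] {k : WithTop ℕ∞} {M : E → Matrix m n ℝ}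
    {x : E} :
    ContDiffAt ℝ k M x ↔ ∀ i j, ContDiffAt ℝ k (fun y => M y i j) x :=
  contDiffAt_pi.trans (forall_congr' fun _ => contDiffAt_pi)

theorem contDiff_mulVec [Fintype m] [Fintype n] {k : WithTop ℕ∞} {M : E → Matrix m n ℝ}
    {v : E → n → ℝ}
    (hM : ContDiff ℝ k M) (hv : ContDiff ℝ k v) : ContDiff ℝ k fun x => M x *ᵥ v x :=
  contDiff_pi.2 fun i => ContDiff.sum fun j _ =>
    (contDiff_matrix_iff.1 hM i j).mul (contDiff_pi.1 hv j)

theorem contDiff_matrix_mul [Fintype l] [Fintype m] [Fintype n] {k : WithTop ℕ∞}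
    {M : E → Matrix l m ℝ} {N : E → Matrix m n ℝ}
    (hM : ContDiff ℝ k M) (hN : ContDiff ℝ k N) : ContDiff ℝ k fun x => M x * N x := by
  refine contDiff_matrix_iff.2 fun i j => ?_
  simp only [Matrix.mul_apply]
  exact ContDiff.sum fun a _ => (contDiff_matrix_iff.1 hM i a).mul (contDiff_matrix_iff.1 hN a j)

theorem contDiffAt_matrix_mul [Fintype l] [Fintype m] [Fintype n] {k : WithTop ℕ∞}
    {M : E → Matrix l m ℝ} {N : E → Matrix m n ℝ}
    {x : E} (hM : ContDiffAt ℝ k M x) (hN : ContDiffAt ℝ k N x) :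
    ContDiffAt ℝ k (fun x => M x * N x) x := by
  refine contDiffAt_matrix_iff.2 fun i j => ?_
  simp only [Matrix.mul_apply]
  exact ContDiffAt.sum fun a _ =>
    (contDiffAt_matrix_iff.1 hM i a).mul (contDiffAt_matrix_iff.1 hN a j)

theorem fderiv_matrix_apply [Fintype n] {M : E → Matrix m n ℝ} {x : E} (hM : DifferentiableAt ℝ M x)
    (y : E) (i : m) (j : n) : fderiv ℝ (fun z => M z i j) x y = fderiv ℝ M x y i j := by
  have h1 := hasFDerivAt_pi'.1 hM.hasFDerivAt i
  have h2 := hasFDerivAt_pi'.1 h1 j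
  rw [h2.fderiv]; rfl

theorem fderiv_pi_apply {v : E → n → ℝ} {x : E} (hv : DifferentiableAt ℝ v x)
    (y : E) (i : n) : fderiv ℝ (fun z => v z i) x y = fderiv ℝ v x y i := by
  rw [(hasFDerivAt_pi'.1 hv.hasFDerivAt i).fderiv]; rfl

theorem fderiv_mulVec [Fintype n] {M : E → Matrix m n ℝ} {v : E → n → ℝ} {x : E}
    (hM : DifferentiableAt ℝ M x) (hv : DifferentiableAt ℝ v x) (y : E) :
    fderiv ℝ (fun z => M z *ᵥ v z) x y = fderiv ℝ M x y *ᵥ v x + M x *ᵥ fderiv ℝ v x y := by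
  have h : HasFDerivAt (fun z => M z *ᵥ v z)
      (ContinuousLinearMap.pi fun i => ∑ j, (M x i j • (ContinuousLinearMap.proj j ∘L fderiv ℝ v x)
        + v x j • (ContinuousLinearMap.proj (R := ℝ) (φ := fun _ : n => ℝ) j ∘L
          (ContinuousLinearMap.proj (R := ℝ) (φ := fun _ : m => n → ℝ) i ∘L fderiv ℝ M x)))) x := by
    refine hasFDerivAt_pi.2 fun i => HasFDerivAt.fun_sum fun j _ => ?_
    exact (hasFDerivAt_pi'.1 (hasFDerivAt_pi'.1 hM.hasFDerivAt i) j).mul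
      (hasFDerivAt_pi'.1 hv.hasFDerivAt j)
  rw [h.fderiv]
  ext i
  simp only [ContinuousLinearMap.coe_pi', _root_.sum_apply, Matrix.mulVec,
    dotProduct, Pi.add_apply, ← Finset.sum_add_distrib]
  refine Finset.sum_congr rfl fun j _ => ?_
  change M x i j * fderiv ℝ v x y j + v x j * fderiv ℝ M x y i j = _
  ring

/-- The sup norm on entries is not submultiplicative, so the product is not treated as that of a
normed algebra; each column of `N` reduces to the matrix-vector rule. -/
theorem fderiv_matrix_mul [Fintype m] [Fintype n] {M : E → Matrix l m ℝ} {N : E → Matrix m n ℝ}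
    {x : E}
    (hM : DifferentiableAt ℝ M x) (hN : DifferentiableAt ℝ N x) (y : E) :
    fderiv ℝ (fun z => M z * N z) x y = fderiv ℝ M x y * N x + M x * fderiv ℝ N x y := by
  have hN' (j : n) : DifferentiableAt ℝ (fun z a => N z a j) x :=
    differentiableAt_pi.2 fun a => differentiableAt_pi.1 (differentiableAt_pi.1 hN a) j
  have hd (i : l) (j : n) : DifferentiableAt ℝ (fun z => (M z * N z) i j) x := by
    simp only [Matrix.mul_apply]
    exact DifferentiableAt.fun_sum fun a _ =>
      (differentiableAt_pi.1 (differentiableAt_pi.1 hM i) a).mul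
        (differentiableAt_pi.1 (hN' j) a)
  have hMN : DifferentiableAt ℝ (fun z => M z * N z) x :=
    differentiableAt_pi.2 fun i => differentiableAt_pi.2 fun j => hd i j
  ext i j
  have h1 := congrFun (fderiv_mulVec hM (hN' j) y) i
  have h2 : DifferentiableAt ℝ (fun z => M z *ᵥ fun a => N z a j) x :=
    differentiableAt_pi.2 fun i => hd i j
  rw [← fderiv_pi_apply h2] at h1
  rw [← fderiv_matrix_apply hMN]
  refine h1.trans ?_
  have h3 : fderiv ℝ (fun z a => N z a j) x y = fun a => fderiv ℝ N x y a j := by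
    ext a
    rw [← fderiv_pi_apply (hN' j), fderiv_matrix_apply hN]
  rw [h3]; rfl

end Calculus

/-! ### Changes of coordinates and frames -/

section Charts

theorem contDiff_frame (g : SL4) : ContDiff ℝ ∞ (frame g) := by
  refine contDiff_matrix_mul contDiff_const (contDiff_matrix_iff.2 fun i j => ?_)
  rcases i with i | i
  · exact contDiff_matrix_iff.1 contDiff_id i j
  · exact contDiff_const

theorem contDiff_den (g h : SL4) : ContDiff ℝ ∞ (den g h) :=
  (contDiff_matrix_mul contDiff_const contDiff_id).add contDiff_const

theorem contDiff_det : ContDiff ℝ ∞ (Matrix.det : M2 → ℝ) := by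
  have h (i j : Fin 2) : ContDiff ℝ ∞ fun X : M2 => X i j := contDiff_matrix_iff.1 contDiff_id i j
  rw [show (Matrix.det : M2 → ℝ) = fun X => X 0 0 * X 1 1 - X 0 1 * X 1 0 from
    funext Matrix.det_fin_two]
  exact ((h 0 0).mul (h 1 1)).sub ((h 0 1).mul (h 1 0))

theorem contDiffAt_inv {X : M2} (hX : X.det ≠ 0) :
    ContDiffAt ℝ ∞ (fun Y : M2 => Y⁻¹) X := by
  have h (i j : Fin 2) : ContDiffAt ℝ ∞ (fun X : M2 => X i j) X :=
    (contDiff_matrix_iff.1 contDiff_id i j).contDiffAt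
  have hd : ContDiffAt ℝ ∞ (fun Y : M2 => Y.det⁻¹) X := contDiff_det.contDiffAt.inv hX
  simp only [Matrix.inv_def, Matrix.adjugate_fin_two, Ring.inverse_eq_inv']
  refine hd.smul (contDiffAt_matrix_iff.2 fun i j => ?_)
  fin_cases i <;> fin_cases j
  · exact h 1 1
  · exact (h 0 1).neg
  · exact (h 1 0).neg
  · exact h 0 0

theorem contDiffAt_coordChange {g h : SL4} {X : M2} (hX : (den g h X).det ≠ 0) :
    ContDiffAt ℝ ∞ (coordChange g h) X := by
  have h1 : ContDiff ℝ ∞ fun X : M2 =>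
      (transMat g h).toBlocks₁₁ * X + (transMat g h).toBlocks₁₂ :=
    (contDiff_matrix_mul contDiff_const contDiff_id).add contDiff_const
  exact contDiffAt_matrix_mul h1.contDiffAt
    ((contDiffAt_inv hX).comp X (contDiff_den g h).contDiffAt)

theorem eventually_det_den_ne_zero {g h : SL4} {X : M2} (hX : (den g h X).det ≠ 0) :
    ∀ᶠ Y in nhds X, (den g h Y).det ≠ 0 :=
  (contDiff_det.continuous.comp (contDiff_den g h).continuous).continuousAt.eventually_ne hX

theorem coordChange_mul_den {g h : SL4} {X : M2} (hX : (den g h X).det ≠ 0) :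
    coordChange g h X * den g h X =
      (transMat g h).toBlocks₁₁ * X + (transMat g h).toBlocks₁₂ := by
  rw [coordChange, Matrix.mul_assoc, Matrix.nonsing_inv_mul _ hX.isUnit, Matrix.mul_one]

theorem fderiv_affine (A B X H : M2) : fderiv ℝ (fun Y : M2 => A * Y + B) X H = A * H := by
  have h1 : fderiv ℝ (fun Y : M2 => A * Y + B) X = fderiv ℝ (fun Y : M2 => A * Y) X :=
    fderiv_add_const B
  have h2 : fderiv ℝ (fun Y : M2 => A * Y) X H =
      fderiv ℝ (fun _ : M2 => A) X H * X + A * fderiv ℝ (fun Y : M2 => Y) X H :=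
    fderiv_matrix_mul (differentiableAt_const A) differentiableAt_id H
  have h3 : fderiv ℝ (fun _ : M2 => A) X = 0 := fderiv_const_apply A
  have h4 : fderiv ℝ (fun Y : M2 => Y) X = ContinuousLinearMap.id ℝ M2 := fderiv_id
  rw [h1, h2, h3, h4]
  simp

theorem fderiv_den (g h : SL4) (X H : M2) :
    fderiv ℝ (den g h) X H = (transMat g h).toBlocks₂₁ * H :=
  fderiv_affine _ _ X H

/-- Differentiating `Ψ D = k₁₁X + k₁₂` avoids the derivative of the inverse matrix. -/
theorem fderiv_coordChange_mul_den {g h : SL4} {X : M2} (hX : (den g h X).det ≠ 0) (H : M2) :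
    fderiv ℝ (coordChange g h) X H * den g h X =
      ((transMat g h).toBlocks₁₁ - coordChange g h X * (transMat g h).toBlocks₂₁) * H := by
  have h1 : fderiv ℝ (fun Y => coordChange g h Y * den g h Y) X H =
      fderiv ℝ (coordChange g h) X H * den g h X + coordChange g h X * fderiv ℝ (den g h) X H :=
    fderiv_matrix_mul ((contDiffAt_coordChange hX).differentiableAt (by simp))
    ((contDiff_den g h).contDiffAt.differentiableAt (x := X) (by simp)) H
  have h2 : fderiv ℝ (fun Y => coordChange g h Y * den g h Y) X =
      fderiv ℝ (fun Y => (transMat g h).toBlocks₁₁ * Y + (transMat g h).toBlocks₁₂) X :=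
    Filter.EventuallyEq.fderiv_eq
      ((eventually_det_den_ne_zero hX).mono fun Y hY => coordChange_mul_den hY)
  rw [h2, fderiv_affine, fderiv_den] at h1
  rw [Matrix.sub_mul, h1, Matrix.mul_assoc, add_sub_cancel_right]

/-- The blocks of `k (X ; I)` are `k₁₁X + k₁₂ = Ψ D` and `D`, so `k (X ; I) = (Ψ ; I) D`; multiply
by `h`, using `h k = g`. -/
theorem frame_eq_frame_mul_den {g h : SL4} {X : M2} (hX : (den g h X).det ≠ 0) :
    frame g X = frame h (coordChange g h X) * den g h X := by
  have h1 : Matrix.fromRows (coordChange g h X) (1 : M2) * den g h X =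
      transMat g h * Matrix.fromRows X (1 : M2) := by
    rw [Matrix.fromRows_mul, coordChange_mul_den hX, Matrix.one_mul]
    conv_rhs => rw [← Matrix.fromBlocks_toBlocks (transMat g h)]
    rw [Matrix.fromBlocks_mul_fromRows, Matrix.mul_one, Matrix.mul_one]
    rfl
  rw [frame, frame, Matrix.mul_assoc, h1, ← Matrix.mul_assoc, transMat,
    ← Matrix.SpecialLinearGroup.coe_mul, mul_inv_cancel_left]

theorem chart_coordChange {g h : SL4} {X : M2} (hX : (den g h X).det ≠ 0) :
    chart h (coordChange g h X) = chart g X := by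
  apply Subtype.ext
  change LinearMap.range _ = LinearMap.range _
  apply le_antisymm
  · rintro _ ⟨v, rfl⟩
    refine ⟨(den g h X)⁻¹ *ᵥ v, ?_⟩
    rw [frame_eq_frame_mul_den hX, Matrix.mulVecLin_apply, Matrix.mulVecLin_apply,
      Matrix.mulVec_mulVec, Matrix.mul_assoc, Matrix.mul_nonsing_inv _ hX.isUnit, Matrix.mul_one]
  · rintro _ ⟨v, rfl⟩
    refine ⟨den g h X *ᵥ v, ?_⟩
    rw [frame_eq_frame_mul_den hX, Matrix.mulVecLin_apply, Matrix.mulVecLin_apply,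
      Matrix.mulVec_mulVec]

theorem frame_mulVec_mem (g : SL4) (X : M2) (v : Fin 2 → ℝ) : frame g X *ᵥ v ∈ (chart g X).1 :=
  ⟨v, rfl⟩

end Charts

/-! ### Coefficient vectors of sections -/

section Coefficients

/-- The left inverse of every frame over the chart of `g`: the lower half of `g⁻¹ w`. -/
def lower (g : SL4) (w : R4) : Fin 2 → ℝ := fun i =>
  (((g⁻¹ : SL4) : Matrix (Fin 2 ⊕ Fin 2) (Fin 2 ⊕ Fin 2) ℝ) *ᵥ w) (Sum.inr i)

/-- The lower block of `g⁻¹ g (X ; I)` is `I`. This left inverse does not depend on `X`, which makes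
coefficient vectors of smooth sections smooth at once. -/
theorem lower_frame (g : SL4) (X : M2) (v : Fin 2 → ℝ) : lower g (frame g X *ᵥ v) = v := by
  funext i
  simp only [lower, frame]
  rw [Matrix.mulVec_mulVec, ← Matrix.mul_assoc, ← Matrix.SpecialLinearGroup.coe_mul,
    inv_mul_cancel, Matrix.SpecialLinearGroup.coe_one, Matrix.one_mul]
  simp [Matrix.fromRows_mulVec]

/-- The coefficient vector of a section of the universal bundle in the frame of a chart. -/
def coeffVec (g : SL4) (σ : sections) (X : M2) : Fin 2 → ℝ := lower g (σ.1 (chart g X))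

theorem frame_coeffVec (g : SL4) (σ : sections) (X : M2) :
    frame g X *ᵥ coeffVec g σ X = σ.1 (chart g X) := by
  obtain ⟨v, hv⟩ := σ.2.1 (chart g X)
  rw [coeffVec, ← hv, Matrix.mulVecLin_apply, lower_frame]

theorem coeffVec_eq {g : SL4} {σ : sections} {v : M2 → Fin 2 → ℝ}
    (hv : ∀ X, σ.1 (chart g X) = frame g X *ᵥ v X) : coeffVec g σ = v :=
  funext fun X => by rw [coeffVec, hv, lower_frame]

theorem contDiff_coeffVec (g : SL4) (σ : sections) : ContDiff ℝ ∞ (coeffVec g σ) :=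
  contDiff_pi.2 fun i => contDiff_pi.1
    (contDiff_mulVec (M := fun _ => ((g⁻¹ : SL4) : Matrix (Fin 2 ⊕ Fin 2) (Fin 2 ⊕ Fin 2) ℝ))
      contDiff_const (σ.2.2 g)) (Sum.inr i)

theorem coeffVec_add (g : SL4) (σ τ : sections) :
    coeffVec g (σ + τ) = coeffVec g σ + coeffVec g τ := by
  ext X i
  simp [coeffVec, lower, Matrix.mulVec_add]

theorem coeffVec_smul (g : SL4) (c : ℝ) (σ : sections) :
    coeffVec g (c • σ) = c • coeffVec g σ := by
  ext X i
  simp [coeffVec, lower, Matrix.mulVec_smul]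

theorem coeffVec_mulSection (g : SL4) (f : Gr → ℝ) (hf : SmoothOnGr f) (σ : sections) :
    coeffVec g (mulSection f hf σ) = fun X => f (chart g X) • coeffVec g σ X := by
  ext X i
  simp [coeffVec, lower, mulSection, Matrix.mulVec_smul]

theorem coeffVec_coordChange {g h : SL4} {X : M2} (hX : (den g h X).det ≠ 0) (σ : sections) :
    coeffVec h σ (coordChange g h X) = den g h X *ᵥ coeffVec g σ X := by
  rw [coeffVec, chart_coordChange hX, ← frame_coeffVec, frame_eq_frame_mul_den hX,
    ← Matrix.mulVec_mulVec, lower_frame]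

theorem fderiv_coeffVec_coordChange {g h : SL4} {X : M2} (hX : (den g h X).det ≠ 0)
    (σ : sections) (H : M2) :
    fderiv ℝ (coeffVec h σ) (coordChange g h X) (fderiv ℝ (coordChange g h) X H) =
      ((transMat g h).toBlocks₂₁ * H) *ᵥ coeffVec g σ X
        + den g h X *ᵥ fderiv ℝ (coeffVec g σ) X H := by
  have h1 : fderiv ℝ (fun Y => coeffVec h σ (coordChange g h Y)) X =
      fderiv ℝ (fun Y => den g h Y *ᵥ coeffVec g σ Y) X :=
    Filter.EventuallyEq.fderiv_eq
      ((eventually_det_den_ne_zero hX).mono fun Y hY => coeffVec_coordChange hY σ)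
  have h2 : fderiv ℝ (fun Y => den g h Y *ᵥ coeffVec g σ Y) X H =
      fderiv ℝ (den g h) X H *ᵥ coeffVec g σ X + den g h X *ᵥ fderiv ℝ (coeffVec g σ) X H :=
    fderiv_mulVec ((contDiff_den g h).contDiffAt.differentiableAt (by simp))
      ((contDiff_coeffVec g σ).contDiffAt.differentiableAt (by simp)) H
  have h3 : fderiv ℝ (fun Y => coeffVec h σ (coordChange g h Y)) X =
      (fderiv ℝ (coeffVec h σ) (coordChange g h X)).comp (fderiv ℝ (coordChange g h) X) :=
    fderiv_comp X ((contDiff_coeffVec h σ).contDiffAt.differentiableAt (by simp))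
      ((contDiffAt_coordChange hX).differentiableAt (by simp))
  rw [← fderiv_den, ← h2, ← h1, h3]
  rfl

end Coefficients

/-! ### The gauge law of the ansatz -/

section Transformation

theorem trace_matGrad_mul (f : M2 → ℝ) (X H : M2) :
    (matGrad f X * H).trace = fderiv ℝ f X H := by
  conv_rhs => rw [Matrix.matrix_eq_sum_single H]
  have h (i j : Fin 2) : Matrix.single i j (H i j) = H i j • Matrix.single i j (1 : ℝ) := by simp
  simp only [h, map_sum, map_smul, Matrix.trace, Matrix.diag, Matrix.mul_apply, matGrad, pd,
    Matrix.of_apply, smul_eq_mul]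
  rw [Finset.sum_comm]
  exact Finset.sum_congr rfl fun _ _ => Finset.sum_congr rfl fun _ _ => mul_comm _ _

/-- Jacobi's formula, read off from the explicit `2 × 2` determinant. -/
theorem fderiv_det {M : M2 → M2} {X : M2} (hM : DifferentiableAt ℝ M X) (H : M2) :
    fderiv ℝ (fun Y => (M Y).det) X H = ((M X).adjugate * fderiv ℝ M X H).trace := by
  have hd (i j : Fin 2) : HasFDerivAt (fun Y => M Y i j) (fderiv ℝ (fun Y => M Y i j) X) X :=
    (differentiableAt_pi.1 (differentiableAt_pi.1 hM i) j).hasFDerivAt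
  have h1 := ((hd 0 0).mul (hd 1 1)).sub ((hd 0 1).mul (hd 1 0))
  rw [show (fun Y => (M Y).det) = fun Y => M Y 0 0 * M Y 1 1 - M Y 0 1 * M Y 1 0 from
    funext fun Y => Matrix.det_fin_two (M Y)]
  have h2 (i j : Fin 2) : fderiv ℝ (fun Y => M Y i j) X H = fderiv ℝ M X H i j :=
    fderiv_matrix_apply hM H i j
  have h3 : fderiv ℝ (fun Y => M Y 0 0 * M Y 1 1 - M Y 0 1 * M Y 1 0) X H =
      M X 0 0 * fderiv ℝ (fun Y => M Y 1 1) X H + M X 1 1 * fderiv ℝ (fun Y => M Y 0 0) X H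
        - (M X 0 1 * fderiv ℝ (fun Y => M Y 1 0) X H
          + M X 1 0 * fderiv ℝ (fun Y => M Y 0 1) X H) :=
    DFunLike.congr_fun h1.fderiv H
  rw [h3]
  simp only [h2, Matrix.adjugate_fin_two, Matrix.trace_fin_two, Matrix.mul_apply, Fin.sum_univ_two]
  simp
  ring

/-- Squaring turns the factor `|det D|` into the polynomial `(det D)²`, so it can be differentiated
without discussing signs. -/
theorem coeff_coordChange_sq (s : NonvanishingSection) {g h : SL4} {X : M2}
    (hX : (den g h X).det ≠ 0) :
    s.1.coeff h (coordChange g h X) ^ 2 = (den g h X).det ^ 2 * s.1.coeff g X ^ 2 := by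
  rw [s.1.compat g h X hX, twistedEpsTransition, epsTransition, tildeTransition, mul_pow, mul_pow,
    div_pow, sq_abs, div_self (pow_ne_zero 2 hX), mul_one]
  simp

/-- The logarithmic derivatives of the coefficients of a section in two charts differ by that of
the determinant of the transition function. -/
theorem logDeriv_coeff_coordChange (s : NonvanishingSection) {g h : SL4} {X : M2}
    (hX : (den g h X).det ≠ 0) (H : M2) :
    (s.1.coeff h (coordChange g h X))⁻¹ *
        fderiv ℝ (s.1.coeff h) (coordChange g h X) (fderiv ℝ (coordChange g h) X H) =
      ((den g h X)⁻¹ * ((transMat g h).toBlocks₂₁ * H)).trace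
        + (s.1.coeff g X)⁻¹ * fderiv ℝ (s.1.coeff g) X H := by
  have hden : DifferentiableAt ℝ (den g h) X :=
    (contDiff_den g h).contDiffAt.differentiableAt (by simp)
  have hc (k : SL4) (Y : M2) : DifferentiableAt ℝ (s.1.coeff k) Y :=
    (s.1.smooth k).contDiffAt.differentiableAt (by simp)
  have hdet : DifferentiableAt ℝ (fun Y => (den g h Y).det) X :=
    (contDiff_det.comp (contDiff_den g h)).contDiffAt.differentiableAt (by simp)
  have h1 : fderiv ℝ (fun Y => s.1.coeff h (coordChange g h Y) ^ 2) X =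
      fderiv ℝ (fun Y => (den g h Y).det ^ 2 * s.1.coeff g Y ^ 2) X :=
    Filter.EventuallyEq.fderiv_eq
      ((eventually_det_den_ne_zero hX).mono fun Y hY => coeff_coordChange_sq s hY)
  have h2 := ((hc h _).hasFDerivAt.comp X
    ((contDiffAt_coordChange hX).differentiableAt (by simp)).hasFDerivAt).pow 2
  have h3 := (hdet.hasFDerivAt.pow 2).mul ((hc g X).hasFDerivAt.pow 2)
  have h4 := (h2.fderiv.symm.trans h1).trans h3.fderiv
  have h5 : 2 * s.1.coeff h (coordChange g h X) *
        fderiv ℝ (s.1.coeff h) (coordChange g h X) (fderiv ℝ (coordChange g h) X H) =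
      (den g h X).det ^ 2 * (2 * s.1.coeff g X * fderiv ℝ (s.1.coeff g) X H)
        + s.1.coeff g X ^ 2 *
          (2 * (den g h X).det * fderiv ℝ (fun Y => (den g h Y).det) X H) := by
    have := DFunLike.congr_fun h4 H
    simp at this
    exact this
  have h6 : fderiv ℝ (fun Y => (den g h Y).det) X H =
      (den g h X).det * ((den g h X)⁻¹ * ((transMat g h).toBlocks₂₁ * H)).trace := by
    rw [fderiv_det hden, fderiv_den, Matrix.inv_def, Matrix.smul_mul, Matrix.trace_smul,
      Ring.inverse_eq_inv', smul_eq_mul, mul_inv_cancel_left₀ hX]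
  have h7 := coeff_coordChange_sq s hX
  have hg := s.2 g X
  have hh := s.2 h (coordChange g h X)
  rw [h6] at h5
  generalize s.1.coeff h (coordChange g h X) = a at *
  generalize s.1.coeff g X = b at *
  generalize (den g h X).det = d at *
  generalize ((den g h X)⁻¹ * ((transMat g h).toBlocks₂₁ * H)).trace = t at *
  generalize fderiv ℝ (s.1.coeff h) (coordChange g h X) (fderiv ℝ (coordChange g h) X H) = p at *
  generalize fderiv ℝ (s.1.coeff g) X H = q at *
  -- Only `a ^ 2` and `a * p` are known in terms of the other chart, so `a⁻¹ * p` is expressed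
  -- through them.
  have h8 : a⁻¹ * p = (a ^ 2)⁻¹ * (a * p) := by field_simp
  have h9 : a * p = d ^ 2 * b * q + b ^ 2 * d ^ 2 * t := by linarith
  rw [h8, h9, h7]
  field_simp
  ring

/-- The gauge transformation law of the ansatz. -/
theorem den_mul_ansatz (s : NonvanishingSection) {g h : SL4} {X : M2}
    (hX : (den g h X).det ≠ 0) (H : M2) :
    den g h X * localAnsatz (s.1.coeff g) X H =
      (transMat g h).toBlocks₂₁ * H
        + localAnsatz (s.1.coeff h) (coordChange g h X) (fderiv ℝ (coordChange g h) X H)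
          * den g h X := by
  set D := den g h X with hD
  set B := (s.1.coeff g X)⁻¹ • matGrad (s.1.coeff g) X with hB
  set C := (s.1.coeff h (coordChange g h X))⁻¹ • matGrad (s.1.coeff h) (coordChange g h X) with hC
  set N := (transMat g h).toBlocks₁₁ - coordChange g h X * (transMat g h).toBlocks₂₁ with hN
  have hu : IsUnit D.det := hX.isUnit
  -- The trace pairing is nondegenerate: it suffices to test against every `K`, and there the
  -- identity is the law for logarithmic derivatives with `dΨ(K) = N K D⁻¹` and a cyclic rotation of
  -- the trace.
  have key : B = D⁻¹ * (C * N - (transMat g h).toBlocks₂₁) := by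
    refine Matrix.ext_iff_trace_mul_right.2 fun K => ?_
    have h1 : fderiv ℝ (coordChange g h) X K = N * K * D⁻¹ := by
      rw [← fderiv_coordChange_mul_den hX, ← hD, Matrix.mul_assoc, Matrix.mul_nonsing_inv _ hu,
        Matrix.mul_one]
    have h2 := logDeriv_coeff_coordChange s hX K
    have h3 (c : ℝ) (f : M2 → ℝ) (Y L : M2) :
        c * fderiv ℝ f Y L = ((c • matGrad f Y) * L).trace := by
      rw [← trace_matGrad_mul, Matrix.smul_mul, Matrix.trace_smul, smul_eq_mul]
    rw [h3, h3, ← hB, ← hC, h1, ← Matrix.mul_assoc, Matrix.trace_mul_comm] at h2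
    rw [Matrix.mul_assoc, Matrix.sub_mul, Matrix.mul_sub, Matrix.trace_sub, Matrix.mul_assoc, h2]
    ring
  change D * (-B * H) = _ + -C * fderiv ℝ (coordChange g h) X H * D
  rw [Matrix.mul_assoc (-C), hD, fderiv_coordChange_mul_den hX, ← hD, ← hN, key, Matrix.neg_mul,
    Matrix.mul_neg, ← Matrix.mul_assoc, ← Matrix.mul_assoc, Matrix.mul_nonsing_inv _ hu,
    Matrix.one_mul, Matrix.sub_mul, Matrix.neg_mul, Matrix.mul_assoc]
  abel

end Transformation

/-! ### Gluing to a connection, and its uniqueness -/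

section Existence

/-- The covariant derivative of the coefficient vector `v` for the potential `A`. -/
def covDeriv (A : M2 → M2 →ₗ[ℝ] M2) (v : M2 → Fin 2 → ℝ) (X : M2) : M2 →ₗ[ℝ] Fin 2 → ℝ :=
  (fderiv ℝ v X).toLinearMap + (Matrix.mulVecBilin ℝ ℝ).flip (v X) ∘ₗ A X

theorem covDeriv_apply (A : M2 → M2 →ₗ[ℝ] M2) (v : M2 → Fin 2 → ℝ) (X H : M2) :
    covDeriv A v X H = fderiv ℝ v X H + A X H *ᵥ v X := rfl

theorem contDiff_fderiv_apply {F : Type*} [NormedAddCommGroup F] [NormedSpace ℝ F] {f : M2 → F}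
    (hf : ContDiff ℝ ∞ f) (H : M2) : ContDiff ℝ ∞ fun X => fderiv ℝ f X H :=
  (hf.fderiv_right (m := ∞) (by simp)).clm_apply contDiff_const

theorem contDiff_localAnsatz {f : M2 → ℝ} (hf : ContDiff ℝ ∞ f) (h0 : ∀ X, f X ≠ 0) (H : M2) :
    ContDiff ℝ ∞ fun X => localAnsatz f X H := by
  have h1 : ContDiff ℝ ∞ fun X => (f X)⁻¹ • matGrad f X :=
    (hf.inv h0).smul (contDiff_matrix_iff.2 fun i j => contDiff_fderiv_apply hf _)
  exact contDiff_matrix_mul h1.neg contDiff_const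

/-- The one-form with values in the universal bundle which the ansatz assigns to a section. -/
def ansatzForm (s : NonvanishingSection) (σ : sections) : oneForms :=
  ⟨fun g X => (frame g X).mulVecLin ∘ₗ covDeriv (localAnsatz (s.1.coeff g)) (coeffVec g σ) X, by
    refine ⟨fun g H => ?_, fun g X H => frame_mulVec_mem g X _, fun g h X hX H => ?_⟩
    · exact contDiff_mulVec (contDiff_frame g)
        ((contDiff_fderiv_apply (contDiff_coeffVec g σ) H).add
          (contDiff_mulVec (contDiff_localAnsatz (s.1.smooth g) (s.2 g) H)
            (contDiff_coeffVec g σ)))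
    -- Compatibility on overlaps: the term `k₂₁ H v` from differentiating `D v` is the inhomogeneous
    -- term of the gauge law.
    · simp only [LinearMap.comp_apply, Matrix.mulVecLin_apply, covDeriv_apply]
      rw [frame_eq_frame_mul_den hX, ← Matrix.mulVec_mulVec, fderiv_coeffVec_coordChange hX,
        coeffVec_coordChange hX, Matrix.mulVec_add, Matrix.mulVec_mulVec (M := den g h X),
        den_mul_ansatz s hX, Matrix.add_mulVec, Matrix.mulVec_mulVec]
      congr 1
      abel⟩

theorem ansatzForm_apply (s : NonvanishingSection) (σ : sections) (g : SL4) (X H : M2) :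
    (ansatzForm s σ).1 g X H = frame g X *ᵥ (fderiv ℝ (coeffVec g σ) X H
      + localAnsatz (s.1.coeff g) X H *ᵥ coeffVec g σ X) := rfl

theorem oneForms_ext {w w' : oneForms} (h : ∀ g X H, w.1 g X H = w'.1 g X H) : w = w' :=
  Subtype.ext (funext fun g => funext fun X => LinearMap.ext fun H => h g X H)

/-- The connection which the ansatz assigns to a nowhere vanishing section. -/
def ansatzConnection (s : NonvanishingSection) : Connection where
  toFun :=
    { toFun := ansatzForm s
      map_add' := fun σ τ => oneForms_ext fun g X H => by
        have h1 : fderiv ℝ (coeffVec g σ + coeffVec g τ) X =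
            fderiv ℝ (coeffVec g σ) X + fderiv ℝ (coeffVec g τ) X :=
          fderiv_add ((contDiff_coeffVec g σ).contDiffAt.differentiableAt (by simp))
            ((contDiff_coeffVec g τ).contDiffAt.differentiableAt (by simp))
        change _ = (ansatzForm s σ).1 g X H + (ansatzForm s τ).1 g X H
        rw [ansatzForm_apply, ansatzForm_apply, ansatzForm_apply, coeffVec_add, h1,
          ← Matrix.mulVec_add, Pi.add_apply, Matrix.mulVec_add (localAnsatz _ X H)]
        congr 1
        exact add_add_add_comm _ _ _ _
      map_smul' := fun c σ => oneForms_ext fun g X H => by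
        have h1 : fderiv ℝ (c • coeffVec g σ) X = c • fderiv ℝ (coeffVec g σ) X :=
          fderiv_const_smul ((contDiff_coeffVec g σ).contDiffAt.differentiableAt (by simp)) c
        change _ = c • (ansatzForm s σ).1 g X H
        rw [ansatzForm_apply, ansatzForm_apply, coeffVec_smul, h1, ← Matrix.mulVec_smul,
          Pi.smul_apply, Matrix.mulVec_smul (localAnsatz _ X H), smul_add]
        rfl }
  leibniz := fun f hf σ g X H => by
    have hv : DifferentiableAt ℝ (coeffVec g σ) X :=
      (contDiff_coeffVec g σ).contDiffAt.differentiableAt (by simp)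
    have h1 : fderiv ℝ (fun Y => f (chart g Y) • coeffVec g σ Y) X H =
        f (chart g X) • fderiv ℝ (coeffVec g σ) X H
          + fderiv ℝ (fun Y => f (chart g Y)) X H • coeffVec g σ X :=
      DFunLike.congr_fun (fderiv_fun_smul ((hf g).contDiffAt.differentiableAt (by simp)) hv) H
    change (ansatzForm s (mulSection f hf σ)).1 g X H =
      _ + f (chart g X) • (ansatzForm s σ).1 g X H
    rw [ansatzForm_apply, ansatzForm_apply, coeffVec_mulSection, h1, ← frame_coeffVec,
      ← Matrix.mulVec_smul, ← Matrix.mulVec_smul, ← Matrix.mulVec_add, Matrix.mulVec_smul,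
      smul_add]
    congr 1
    abel

theorem isGlobalAnsatz_ansatzConnection : IsGlobalAnsatz ansatzConnection := fun s g =>
  ⟨contDiff_localAnsatz (s.1.smooth g) (s.2 g), fun σ v hv X H => by
    rw [← coeffVec_eq hv]; rfl⟩

theorem Connection.eq_of_isPotential {D D' : Connection} {A : SL4 → M2 → M2 →ₗ[ℝ] M2}
    (h : ∀ g, D.IsPotential g (A g)) (h' : ∀ g, D'.IsPotential g (A g)) : D = D' := by
  ext1
  refine LinearMap.ext fun σ => oneForms_ext fun g X H => ?_
  have hv (X : M2) : σ.1 (chart g X) = frame g X *ᵥ coeffVec g σ X := (frame_coeffVec g σ X).symm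
  rw [(h g).2 σ _ hv, (h' g).2 σ _ hv]

theorem IsGlobalAnsatz.unique {φ ψ : NonvanishingSection → Connection} (hφ : IsGlobalAnsatz φ)
    (hψ : IsGlobalAnsatz ψ) : φ = ψ :=
  funext fun s => Connection.eq_of_isPotential (hφ s) (hψ s)

end Existence

/-! ### Global sections with prescribed values, and uniqueness of potentials -/

section Projection

theorem frame_mulVec_injective {g : SL4} {X : M2} {v w : Fin 2 → ℝ}
    (h : frame g X *ᵥ v = frame g X *ᵥ w) : v = w :=
  frame_injective g X h

theorem det_frame_gram_ne_zero (g : SL4) (X : M2) : ((frame g X)ᵀ * frame g X).det ≠ 0 := by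
  intro h
  obtain ⟨v, hv, h0⟩ := Matrix.exists_mulVec_eq_zero_iff.2 h
  refine hv (frame_mulVec_injective (g := g) (X := X) ?_)
  rw [Matrix.mulVec_zero]
  have h1 : v ∈ LinearMap.ker ((frame g X)ᵀ * frame g X).mulVecLin := h0
  rwa [Matrix.ker_mulVecLin_transpose_mul_self] at h1

/-- The coefficients of the orthogonal projection of `e` to the fibre over `Ψ_g(X)`. -/
def projCoeff (e : R4) (g : SL4) (X : M2) : Fin 2 → ℝ :=
  ((frame g X)ᵀ * frame g X)⁻¹ *ᵥ ((frame g X)ᵀ *ᵥ e)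

/-- `q` is the orthogonal projection of `e` to `p`. -/
def IsProj (p : Submodule ℝ R4) (e q : R4) : Prop := q ∈ p ∧ ∀ w ∈ p, w ⬝ᵥ (e - q) = 0

theorem IsProj.unique {p : Submodule ℝ R4} {e q q' : R4} (h : IsProj p e q) (h' : IsProj p e q') :
    q = q' := by
  have h1 := p.sub_mem h.1 h'.1
  have h2 := h.2 _ h1
  have h3 := h'.2 _ h1
  rw [← sub_eq_zero, ← dotProduct_self_eq_zero]
  have h4 : q - q' = (e - q') - (e - q) := by abel
  rw [show (q - q') ⬝ᵥ (q - q') = (q - q') ⬝ᵥ (e - q') - (q - q') ⬝ᵥ (e - q) by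
    rw [← dotProduct_sub, ← h4], h2, h3, sub_zero]

theorem isProj_frame (e : R4) (g : SL4) (X : M2) :
    IsProj (chart g X).1 e (frame g X *ᵥ projCoeff e g X) := by
  refine ⟨frame_mulVec_mem g X _, ?_⟩
  rintro _ ⟨v, rfl⟩
  have h1 : (frame g X)ᵀ *ᵥ (e - frame g X *ᵥ projCoeff e g X) = 0 := by
    rw [Matrix.mulVec_sub, projCoeff, Matrix.mulVec_mulVec, Matrix.mulVec_mulVec,
      Matrix.mul_nonsing_inv _ (det_frame_gram_ne_zero g X).isUnit, Matrix.one_mulVec, sub_self]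
  rw [Matrix.mulVecLin_apply, dotProduct_comm, Matrix.dotProduct_mulVec, ← Matrix.mulVec_transpose,
    h1, zero_dotProduct]

open Classical in
/-- The section of the universal bundle given by the orthogonal projections of a fixed vector. -/
def projFun (e : R4) (p : Gr) : R4 := if h : ∃ q, IsProj p.1 e q then h.choose else 0

/-- Orthogonal projections are unique, so the chosen value agrees in every chart with the formula `u
(uᵀu)⁻¹ uᵀ e`, from which smoothness is visible. The default `0` never occurs over a chart. -/
theorem projFun_chart (e : R4) (g : SL4) (X : M2) :
    projFun e (chart g X) = frame g X *ᵥ projCoeff e g X := by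
  have h : ∃ q, IsProj (chart g X).1 e q := ⟨_, isProj_frame e g X⟩
  rw [projFun, dif_pos h]
  exact h.choose_spec.unique (isProj_frame e g X)

theorem contDiff_projCoeff (e : R4) (g : SL4) : ContDiff ℝ ∞ (projCoeff e g) := by
  have h1 : ContDiff ℝ ∞ fun X => (frame g X)ᵀ :=
    contDiff_matrix_iff.2 fun i j => contDiff_matrix_iff.1 (contDiff_frame g) j i
  have h2 := contDiff_matrix_mul h1 (contDiff_frame g)
  exact contDiff_mulVec (contDiff_iff_contDiffAt.2 fun X =>
    (contDiffAt_inv (det_frame_gram_ne_zero g X)).comp X h2.contDiffAt)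
    (contDiff_mulVec h1 contDiff_const)

/-- `projFun` as a smooth section. -/
def projSection (e : R4) : sections :=
  ⟨projFun e, fun p => by
    rw [projFun]
    split_ifs with h
    · exact h.choose_spec.1
    · exact p.1.zero_mem, fun g => by
    simp only [projFun_chart]
    exact contDiff_mulVec (contDiff_frame g) (contDiff_projCoeff e g)⟩

/-- Projection fixes a vector that already lies in the plane, so projecting the constant vector
`u_g(X) v` works and no cutoff function is needed. -/
theorem exists_section_coeffVec_eq (g : SL4) (X : M2) (v : Fin 2 → ℝ) :
    ∃ σ : sections, coeffVec g σ X = v := by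
  refine ⟨projSection (frame g X *ᵥ v), ?_⟩
  rw [coeffVec, show (projSection (frame g X *ᵥ v)).1 (chart g X) = frame g X *ᵥ v from ?_,
    lower_frame]
  refine (projFun_chart _ g X).trans ((isProj_frame _ g X).unique
    ⟨frame_mulVec_mem g X v, fun w _ => ?_⟩)
  rw [sub_self, dotProduct_zero]

/-- For a section with coefficient vector `e_j` at `X` the derivative terms agree, and what remains
compares the `j`-th columns of the two potentials. -/
theorem Connection.IsPotential.unique {D : Connection} {g : SL4} {A A' : M2 → M2 →ₗ[ℝ] M2}
    (h : D.IsPotential g A) (h' : D.IsPotential g A') : A = A' := by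
  funext X
  refine LinearMap.ext fun H => Matrix.ext_of_mulVec_single fun j => ?_
  obtain ⟨σ, hσ⟩ := exists_section_coeffVec_eq g X (Pi.single j 1)
  have hv (X : M2) : σ.1 (chart g X) = frame g X *ᵥ coeffVec g σ X := (frame_coeffVec g σ X).symm
  have h1 := (h.2 σ _ hv X H).symm.trans (h'.2 σ _ hv X H)
  rw [← hσ]
  exact add_left_cancel (frame_mulVec_injective h1)

end Projection

/-! ### Anti-self-duality in coordinates -/

section AntiSelfDuality

theorem gram_eq : gram = !![0, 0, 0, 1; 0, 0, -1, 0; 0, -1, 0, 0; 1, 0, 0, 0] := by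
  ext i j
  fin_cases i <;> fin_cases j <;> simp [gram, metric, orientedBasis, Matrix.single]

theorem gram_inv : gram⁻¹ = gram := by
  refine Matrix.inv_eq_left_inv ?_
  rw [gram_eq]
  ext i j
  fin_cases i <;> fin_cases j <;> simp [Matrix.mul_apply, Fin.sum_univ_four]

/-- The Gram matrix is antidiagonal with signs `1, -1, -1, 1` and is its own inverse, so each basis
index `i` is paired with `3 - i`. -/
theorem formInner_eq {α β : M2 → M2 → ℝ} (hα : ∀ H K, α H K = -α K H)
    (hβ : ∀ H K, β H K = -β K H) (a : Fin 4 → M2) (ha : a = orientedBasis) :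
    formInner α β = α (a 0) (a 1) * β (a 2) (a 3) + α (a 0) (a 2) * β (a 1) (a 3)
      - α (a 0) (a 3) * β (a 0) (a 3) - α (a 1) (a 2) * β (a 1) (a 2)
      + α (a 1) (a 3) * β (a 0) (a 2) + α (a 2) (a 3) * β (a 0) (a 1) := by
  subst ha
  rw [formInner, gram_inv, gram_eq]
  generalize orientedBasis = a
  simp [Fin.sum_univ_four]
  rw [hα (a 1) (a 0), hα (a 2) (a 0), hα (a 3) (a 0), hα (a 2) (a 1), hα (a 3) (a 1),
    hα (a 3) (a 2), hβ (a 1) (a 0), hβ (a 2) (a 0), hβ (a 3) (a 0), hβ (a 2) (a 1), hβ (a 3) (a 1),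
    hβ (a 3) (a 2)]
  have h0 (i : Fin 4) : α (a i) (a i) = 0 := by linarith [hα (a i) (a i)]
  rw [h0, h0, h0, h0]
  ring

theorem sum_perm_fin_succ {n : ℕ} (F : Equiv.Perm (Fin (n + 1)) → ℝ) :
    ∑ τ, F τ = ∑ i, ∑ e, F (Equiv.Perm.decomposeFin.symm (i, e)) := by
  rw [← Equiv.Perm.decomposeFin.symm.sum_comp, Fintype.sum_prod_type]

/-- A permutation of `Fin (n + 1)` is the image of `0` together with a permutation of `Fin n`;
iterating this lists all 24 terms with their signs. -/
theorem sum_sign_perm_fin_four (F : Fin 4 → Fin 4 → Fin 4 → Fin 4 → ℝ) :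
    ∑ τ : Equiv.Perm (Fin 4), ((Equiv.Perm.sign τ : ℤ) : ℝ) * F (τ 0) (τ 1) (τ 2) (τ 3) =
      F 0 1 2 3 + -F 0 1 3 2 + (-F 0 2 1 3 + F 0 2 3 1 + (-F 0 3 2 1 + F 0 3 1 2)) +
      (-F 1 0 2 3 + F 1 0 3 2 + (F 1 2 0 3 + -F 1 2 3 0 + (F 1 3 2 0 + -F 1 3 0 2)) +
        (-F 2 1 0 3 + F 2 1 3 0 + (F 2 0 1 3 + -F 2 0 3 1 + (F 2 3 0 1 + -F 2 3 1 0)) +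
          (-F 3 1 2 0 + F 3 1 0 2 +
            (F 3 2 1 0 + -F 3 2 0 1 + (F 3 0 2 1 + -F 3 0 1 2))))) := by
  have h1 : (1 : Fin 4) = Fin.succ 0 := rfl
  have h2 : (2 : Fin 4) = Fin.succ (Fin.succ 0) := rfl
  have h3 : (3 : Fin 4) = Fin.succ (Fin.succ (Fin.succ 0)) := rfl
  rw [h1, h2, h3]
  simp only [sum_perm_fin_succ, Equiv.Perm.decomposeFin_symm_apply_zero,
    Equiv.Perm.decomposeFin_symm_apply_succ, Equiv.Perm.decomposeFin.symm_sign, Fin.sum_univ_succ,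
    Fin.sum_univ_zero]
  simp [Equiv.swap_apply_def, ← h1, Fin.ext_iff]

theorem wedgeCoeff_eq {α β : M2 → M2 → ℝ} (hα : ∀ H K, α H K = -α K H)
    (hβ : ∀ H K, β H K = -β K H) (a : Fin 4 → M2) (ha : a = orientedBasis) :
    wedgeCoeff α β = α (a 0) (a 1) * β (a 2) (a 3) - α (a 0) (a 2) * β (a 1) (a 3)
      + α (a 0) (a 3) * β (a 1) (a 2) + α (a 1) (a 2) * β (a 0) (a 3)
      - α (a 1) (a 3) * β (a 0) (a 2) + α (a 2) (a 3) * β (a 0) (a 1) := by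
  subst ha
  rw [wedgeCoeff]
  generalize orientedBasis = a
  simp only [mul_assoc]
  rw [sum_sign_perm_fin_four fun i j k l => α (a i) (a j) * β (a k) (a l)]
  rw [hα (a 1) (a 0), hα (a 2) (a 0), hα (a 3) (a 0), hα (a 2) (a 1), hα (a 3) (a 1),
    hα (a 3) (a 2), hβ (a 1) (a 0), hβ (a 2) (a 0), hβ (a 3) (a 0), hβ (a 2) (a 1), hβ (a 3) (a 1),
    hβ (a 3) (a 2)]
  ring

/-- The two-form `dx_{ij} ∧ dx_{kl}`. -/
def coordForm (i j k l : Fin 2) : LinearMap.BilinForm ℝ M2 :=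
  LinearMap.mk₂ ℝ (fun H K => H i j * K k l - H k l * K i j)
    (fun _ _ _ => by simp only [Matrix.add_apply]; ring)
    (fun _ _ _ => by simp only [Matrix.smul_apply, smul_eq_mul]; ring)
    (fun _ _ _ => by simp only [Matrix.add_apply]; ring)
    (fun _ _ _ => by simp only [Matrix.smul_apply, smul_eq_mul]; ring)

theorem coordForm_apply (i j k l : Fin 2) (H K : M2) :
    coordForm i j k l H K = H i j * K k l - H k l * K i j := rfl

theorem coordForm_isAlt (i j k l : Fin 2) : (coordForm i j k l).IsAlt := fun H => by
  rw [coordForm_apply]; ring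

/-- Compare coefficients of `α` in `α ∧ (-β) = (α, β) dV`. With the oriented basis numbered from
`0`, those of `α₀₂` and `α₁₃` agree identically, `α₀₁` and `α₂₃` give the two vanishing conditions,
and `α₀₃` and `α₁₂` both give the third. -/
theorem isHodgeStar_neg_iff {β : M2 → M2 → ℝ} (hβ : ∀ H K, β H K = -β K H) :
    IsHodgeStar β (fun H K => -β H K) ↔
      β (Matrix.single 0 0 1) (Matrix.single 1 0 1) = 0 ∧
      β (Matrix.single 0 1 1) (Matrix.single 1 1 1) = 0 ∧
      β (Matrix.single 0 0 1) (Matrix.single 1 1 1) =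
        β (Matrix.single 1 0 1) (Matrix.single 0 1 1) := by
  have hβ' (H K : M2) : -β H K = - -β K H := by rw [hβ]
  have key (α : LinearMap.BilinForm ℝ M2) (hα : α.IsAlt) :=
    have h : ∀ H K, α H K = -α K H := fun H K => (hα.neg_eq K H).symm
    And.intro (wedgeCoeff_eq h hβ' _ rfl) (formInner_eq h hβ _ rfl)
  simp only [orientedBasis, Matrix.cons_val] at key
  constructor
  · intro h
    have h1 := h _ (coordForm_isAlt 0 0 1 0)
    have h2 := h _ (coordForm_isAlt 0 1 1 1)
    have h3 := h _ (coordForm_isAlt 0 0 1 1)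
    rw [(key _ (coordForm_isAlt _ _ _ _)).1, (key _ (coordForm_isAlt _ _ _ _)).2] at h1 h2 h3
    simp [coordForm_apply] at h1 h2 h3
    exact ⟨by linarith, by linarith, by linarith⟩
  · rintro ⟨h1, h2, h3⟩ α hα
    rw [(key α hα).1, (key α hα).2, h1, h2, h3]
    ring

end AntiSelfDuality

/-! ### Curvature of the ansatz -/

section Curvature

theorem fderiv_ansatzMatrix {f : M2 → ℝ} (hf : ContDiff ℝ ∞ f) (h0 : ∀ X, f X ≠ 0) (X : M2)
    (k l i j : Fin 2) :
    fderiv ℝ (fun Y => -((f Y)⁻¹ • matGrad f Y)) X (Matrix.single k l 1) i j =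
      (f X)⁻¹ ^ 2 * pd k l f X * pd j i f X - (f X)⁻¹ * pd k l (pd j i f) X := by
  have hp (i j : Fin 2) : ContDiff ℝ ∞ (pd i j f) := contDiff_fderiv_apply hf _
  have hb : ContDiff ℝ ∞ fun Y => -((f Y)⁻¹ • matGrad f Y) :=
    ((hf.inv h0).smul (contDiff_matrix_iff.2 fun i j => hp j i)).neg
  have h1 : fderiv ℝ (fun Y => -((f Y)⁻¹ • matGrad f Y)) X (Matrix.single k l 1) i j =
      fderiv ℝ (fun Y => -((f Y)⁻¹ * pd j i f Y)) X (Matrix.single k l 1) :=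
    (fderiv_matrix_apply (hb.contDiffAt.differentiableAt (by simp)) _ i j).symm
  have hf1 := (hf.contDiffAt.differentiableAt (x := X) (by simp)).hasFDerivAt
  have hp1 := ((hp j i).contDiffAt.differentiableAt (x := X) (by simp)).hasFDerivAt
  have h2 := (((hasDerivAt_inv (h0 X)).comp_hasFDerivAt X hf1).mul hp1).neg
  rw [h1]
  refine (DFunLike.congr_fun h2.fderiv _).trans ?_
  change -((f X)⁻¹ * pd k l (pd j i f) X + pd j i f X * (-(f X ^ 2)⁻¹ * pd k l f X)) = _
  rw [inv_pow]
  ring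

theorem pd_comm {f : M2 → ℝ} (hf : ContDiff ℝ ∞ f) (X : M2) (i j k l : Fin 2) :
    pd i j (pd k l f) X = pd k l (pd i j f) X := by
  have hd : DifferentiableAt ℝ (fderiv ℝ f) X :=
    (hf.fderiv_right (m := ∞) (by simp)).contDiffAt.differentiableAt (by simp)
  have h (H K : M2) : fderiv ℝ (fun Y => fderiv ℝ f Y K) X H = fderiv ℝ (fderiv ℝ f) X H K := by
    have h1 := (hd.hasFDerivAt.clm_apply (hasFDerivAt_const K X)).fderiv
    exact (DFunLike.congr_fun h1 H).trans
      ((congrArg₂ (· + ·) (map_zero (fderiv ℝ f X)) rfl).trans (zero_add _))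
  have hs : IsSymmSndFDerivAt ℝ f X := hf.contDiffAt.isSymmSndFDerivAt
    (by simpa using ENat.LEInfty.out)
  exact (h _ _).trans ((hs _ _).trans (h _ _).symm)

/-- The potential is a matrix function times the constant form `dX`, so `dA` differentiates only the
matrix factor. -/
theorem curvature_localAnsatz {f : M2 → ℝ} (hf : ContDiff ℝ ∞ f) (h0 : ∀ X, f X ≠ 0)
    (X H K : M2) : curvature (localAnsatz f) X H K =
      fderiv ℝ (fun Y => -((f Y)⁻¹ • matGrad f Y)) X H * K
        - fderiv ℝ (fun Y => -((f Y)⁻¹ • matGrad f Y)) X K * H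
        + (-((f X)⁻¹ • matGrad f X) * H * (-((f X)⁻¹ • matGrad f X) * K)
          - -((f X)⁻¹ • matGrad f X) * K * (-((f X)⁻¹ • matGrad f X) * H)) := by
  have hb : ContDiff ℝ ∞ fun Y => -((f Y)⁻¹ • matGrad f Y) :=
    ((hf.inv h0).smul (contDiff_matrix_iff.2 fun i j => contDiff_fderiv_apply hf _)).neg
  have h (H K : M2) : fderiv ℝ (fun Y => localAnsatz f Y K) X H =
      fderiv ℝ (fun Y => -((f Y)⁻¹ • matGrad f Y)) X H * K := by
    have h1 : fderiv ℝ (fun Y => -((f Y)⁻¹ • matGrad f Y) * K) X H =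
        fderiv ℝ (fun Y => -((f Y)⁻¹ • matGrad f Y)) X H * K
          + -((f X)⁻¹ • matGrad f X) * fderiv ℝ (fun _ : M2 => K) X H :=
      fderiv_matrix_mul (hb.contDiffAt.differentiableAt (by simp)) (differentiableAt_const K) H
    have h2 : fderiv ℝ (fun _ : M2 => K) X = 0 := fderiv_const_apply K
    refine h1.trans ?_
    rw [h2, _root_.zero_apply, Matrix.mul_zero, add_zero]
  rw [curvature, h, h]
  rfl

theorem curvature_antisymm (A : M2 → M2 →ₗ[ℝ] M2) (X H K : M2) :
    curvature A X H K = -curvature A X K H := by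
  simp only [curvature]
  abel

theorem isASDForm_localAnsatz_iff {f : M2 → ℝ} (hf : ContDiff ℝ ∞ f) (h0 : ∀ X, f X ≠ 0)
    (X : M2) : IsASDForm (curvature (localAnsatz f) X) ↔ box f X = 0 := by
  have hF (i j : Fin 2) (H K : M2) :
      curvature (localAnsatz f) X H K i j = -curvature (localAnsatz f) X K H i j := by
    rw [curvature_antisymm, Matrix.neg_apply]
  -- `L` (the derivative of the ansatz matrix) and `B` (its value) are made opaque, so that only
  -- their entries enter the component computations.
  obtain ⟨L, B, hL, hB, hc⟩ : ∃ (L : M2 → M2) (B : M2),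
      (∀ k l i j, L (Matrix.single k l 1) i j =
        (f X)⁻¹ ^ 2 * pd k l f X * pd j i f X - (f X)⁻¹ * pd k l (pd j i f) X) ∧
      (∀ i j, B i j = -((f X)⁻¹ * pd j i f X)) ∧
      ∀ H K, curvature (localAnsatz f) X H K =
        L H * K - L K * H + (B * H * (B * K) - B * K * (B * H)) :=
    ⟨_, -((f X)⁻¹ • matGrad f X), fderiv_ansatzMatrix hf h0 X, fun _ _ => rfl,
      curvature_localAnsatz hf h0 X⟩
  -- Mixed second derivatives are brought to the order in which they occur in `box`.
  have hq1 := pd_comm hf X 1 0 0 0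
  have hq2 := pd_comm hf X 1 0 0 1
  have hq3 := pd_comm hf X 1 1 0 1
  have hq4 := pd_comm hf X 1 1 0 0
  have h1 : curvature (localAnsatz f) X (Matrix.single 0 0 1) (Matrix.single 1 0 1) =
      !![0, 0; -((f X)⁻¹ * box f X), 0] := by
    rw [hc]
    ext i j
    fin_cases i <;> fin_cases j <;>
      simp [Matrix.mul_apply, hB, hL, Matrix.single_apply, box, hq1, hq2] <;> ring
  have h2 : curvature (localAnsatz f) X (Matrix.single 0 1 1) (Matrix.single 1 1 1) =
      !![0, (f X)⁻¹ * box f X; 0, 0] := by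
    rw [hc]
    ext i j
    fin_cases i <;> fin_cases j <;>
      simp [Matrix.mul_apply, hB, hL, Matrix.single_apply, box, hq3, hq4] <;> ring
  have h3 : curvature (localAnsatz f) X (Matrix.single 0 0 1) (Matrix.single 1 1 1) =
      curvature (localAnsatz f) X (Matrix.single 1 0 1) (Matrix.single 0 1 1) +
      !![(f X)⁻¹ * box f X, 0; 0, -((f X)⁻¹ * box f X)] := by
    rw [hc, hc]
    ext i j
    fin_cases i <;> fin_cases j <;>
      simp [Matrix.mul_apply, hB, hL, Matrix.single_apply, box, hq1, hq2, hq3, hq4] <;> ring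
  have h4 (i j : Fin 2) := isHodgeStar_neg_iff (hF i j)
  rw [h1, h2, h3] at h4
  constructor
  · intro h
    -- A single entry suffices: the lower left one of the first component is `-f⁻¹ □f`.
    have h5 := ((h4 1 0).1 (h 1 0)).1
    simpa [h0 X] using h5
  · intro h i j
    refine (h4 i j).2 ?_
    rw [h]
    fin_cases i <;> fin_cases j <;> simp

end Curvature

end SplitHooft

end


open SplitHooft in
theorem mainTheorem3 :
    (∃! φ : NonvanishingSection → Connection, IsGlobalAnsatz φ) ∧
      ∀ φ : NonvanishingSection → Connection, IsGlobalAnsatz φ →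
        ∀ s : NonvanishingSection, (φ s).IsASD ↔ SolvesBox s.1 := by
  refine ⟨⟨ansatzConnection, isGlobalAnsatz_ansatzConnection,
    fun ψ hψ => hψ.unique isGlobalAnsatz_ansatzConnection⟩, fun φ hφ s => ?_⟩
  have h (g : SL4) (X : M2) := isASDForm_localAnsatz_iff (s.1.smooth g) (s.2 g) X
  constructor
  · intro hs g X
    obtain ⟨A, hA, hASD⟩ := hs g
    exact (h g X).1 (hA.unique (hφ s g) ▸ hASD X)
  · exact fun hs g => ⟨_, hφ s g, fun X => (h g X).2 (hs g X)⟩
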